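/- Let $\mathbb{T}=\mathbb{R}/\mathbb{Z}$ and, for $y\in\mathbb{T}$, let $|y|$ denote the distance from $y$ to $0$ in $\mathbb{T}$ (the distance of any real representative to the nearest integer). For a sequence $(x_n)_{n=1}^\infty$ on $\mathbb{T}$ and integers $N,k,T\ge 1$, let $$D_N=\sup_{A}\left|\frac1N\#\{1\le n\le N : x_n\in A\}-|A|\right|,$$ where the supremum is over all intervals (arcs) $A\subset\mathbb{T}$, open, closed or half-open, and $|A|$ is the Lebesgue measure of $A$ (normalized so that $|\mathbb{T}|=1$). Let the $2k$-fold correlation discrepancy be $$D^{(2k)}_{T,N}=\max_{s\in\{0,1,\ldots,T\}}\left(\frac{1}{N^k}\#\left\{(a,b)\in\{1,\ldots,N\}^k\times\{1,\ldots,N\}^k : \{a_j\}\ne\{b_j\},\ \left|\sum_{j=1}^k x_{a_j}-\sum_{j=1}^k x_{b_j}\right|<\frac{s}{N^k}\right\}-2s\right),$$ where $\{a_j\}\neq\{b_j\}$ means that $(a_1,\ldots,a_k)$ and $(b_1,\ldots,b_k)$ differ as unordered tuples (multisets), i.e. neither is a permutation of the other. **Theorem.** There is an absolute constant $C>0$ such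 that for every sequence $(x_n)_{n=1}^\infty$ on $\mathbb{T}$ and all integers $k,T,N\ge 1$, $$D_N\le C\left(\frac{T}{N^k}+k\left(\frac{k!}{T}+\frac{D^{(2k)}_{T,N}}{T}\right)^{\frac1{2k}}\right).$$ -/

import Mathlib

/-- An interval (arc) of the torus `𝕋 = ℝ/ℤ`: the image of an interval of `ℝ`, where the interval may
be open, closed or half-open, bounded or unbounded. -/
def IsTorusInterval (A : Set UnitAddCircle) : Prop :=
  ∃ I : Set ℝ, I.OrdConnected ∧ A = (fun t : ℝ => (t : UnitAddCircle)) '' I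

open Classical in
/-- `(1/N) * #{1 ≤ n ≤ N : x n ∈ A}`, the mass that the empirical measure of the first `N` points
gives to `A`. Sequences are indexed from `1`, the value `x 0` is never used. -/
noncomputable def empiricalMass (x : ℕ → UnitAddCircle) (N : ℕ) (A : Set UnitAddCircle) : ℝ :=
  (((Finset.Icc 1 N).filter (fun n => x n ∈ A)).card : ℝ) / (N : ℝ)

/-- The discrepancy `D_N` of the first `N` points of a sequence on the torus: the supremum over all
intervals `A` of `|μ_N(A) - |A||`, with `|A|` the normalized Haar (Lebesgue) measure of `A`. -/
noncomputable def discrepancy (x : ℕ → UnitAddCircle) (N : ℕ) : ℝ :=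
  ⨆ A : {A : Set UnitAddCircle // IsTorusInterval A},
    |empiricalMass x N A.1 - (MeasureTheory.volume A.1).toReal|

open Classical in
/-- The normalized number of close `2k`-fold differences: `1/N^k` times the number of pairs of index
tuples `(a_1, …, a_k)`, `(b_1, …, b_k)` in `{1, …, N}^k` which differ as unordered tuples (that is, as
multisets) and satisfy `|∑ x_{a_j} - ∑ x_{b_j}| < s / N^k`. The norm on `UnitAddCircle = ℝ/ℤ` is
the distance to the nearest integer. -/
noncomputable def correlationCount (x : ℕ → UnitAddCircle) (k N : ℕ) (s : ℝ) : ℝ :=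
  ((((Fintype.piFinset fun _ : Fin k => Finset.Icc 1 N) ×ˢ
      (Fintype.piFinset fun _ : Fin k => Finset.Icc 1 N)).filter
    (fun p : (Fin k → ℕ) × (Fin k → ℕ) =>
      (Finset.univ.val.map p.1 ≠ Finset.univ.val.map p.2) ∧
        ‖(∑ j, x (p.1 j)) - ∑ j, x (p.2 j)‖ < s / (N : ℝ) ^ k)).card : ℝ) / (N : ℝ) ^ k

/-- The `2k`-fold correlation discrepancy `D^{(2k)}_{T,N}`: the maximum over the integers
`s ∈ {0, …, T}` of `correlationCount x k N s - 2 s`. -/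
noncomputable def correlationDiscrepancy (x : ℕ → UnitAddCircle) (k T N : ℕ) : ℝ :=
  (Finset.range (T + 1)).sup' Finset.nonempty_range_add_one
    (fun s : ℕ => correlationCount x k N (s : ℝ) - 2 * (s : ℝ))

section

open MeasureTheory Real

/-! Put δ = T / N^k and let w(h) be the Weyl sum (1/N) ∑ e(h x_n). The kernel (δ - ‖y‖)₊² has
positive Fourier coefficients, at least of order δ³ min(1, 1/(2π|h|δ))²
(`le_fourierCoeff_truncPow_two`). Summed over all differences ∑ x_{a_j} - ∑ x_{b_j}, it equals a
positively weighted sum of |w(h)|^{2k} (`sum_fourier_differences`). Slicing it at integer thresholds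
bounds the same sum by correlation counts, with k! accounting for tuples equal as multisets
(`sum_truncPow_differences_le`). Frequency 0 cancels the main term, leaving a bound for the weighted
2k-th moment of w (`tsum_weylSum_pow_le`).

A trapezoid majorant of a ball bounds its excess mass by δ + ∑ |h|⁻¹ min(1, 1/(2π|h|δ)) |w(h)|
(`empiricalMass_closedBall_le`). Hölder with exponent 2k (`tsum_inv_mul_le`) inserts the moment
bound at the cost of a factor 4k. Upper bounds for balls suffice, since the complement of an arc is
an arc (`discrepancy_le_of_closedBall_le`). -/

/-! ### Fourier coefficients of radial kernels -/

/-- The function `y ↦ g ‖y‖` on the circle, as a continuous complex-valued function. -/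
noncomputable def radialMap (g : C(ℝ, ℝ)) : C(UnitAddCircle, ℂ) :=
  ⟨fun y => ((g ‖y‖ : ℝ) : ℂ), by fun_prop⟩

/-- Folding [-1/2, 0] onto [0, 1/2] pairs conjugate characters into cosines. -/
theorem fourierCoeff_radialMap (g : C(ℝ, ℝ)) (n : ℤ) :
    fourierCoeff (radialMap g) n =
      ((2 * ∫ t in (0 : ℝ)..1 / 2, g t * cos (2 * π * n * t) : ℝ) : ℂ) := by
  have hnorm : ∀ t : ℝ, |t| ≤ 1 / 2 → ‖(t : UnitAddCircle)‖ = |t| := fun t ht => by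
    rw [AddCircle.norm_coe_eq_abs_iff 1 one_ne_zero]; simpa using ht
  have hchar : ∀ (m : ℤ) (t : ℝ), (fourier m (t : UnitAddCircle) : ℂ) =
      Complex.exp ((2 * π * m * t : ℝ) * Complex.I) := fun m t => by
    rw [fourier_coe_apply]; congr 1; push_cast; ring
  have hcont : Continuous fun x : ℝ =>
      (fourier (-n) (x : UnitAddCircle) : ℂ) • radialMap g (x : UnitAddCircle) := by
    have : Continuous fun x : ℝ => (x : UnitAddCircle) := AddCircle.continuous_mk' 1
    fun_prop
  rw [fourierCoeff_eq_intervalIntegral _ n (-(1 / 2))]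
  rw [show -(1 / 2 : ℝ) + 1 = 1 / 2 by norm_num,
    ← intervalIntegral.integral_add_adjacent_intervals (b := 0)
      (hcont.intervalIntegrable _ _) (hcont.intervalIntegrable _ _)]
  have hneg : (∫ x in (-(1 / 2) : ℝ)..0, (fourier (-n) (x : UnitAddCircle) : ℂ) •
      radialMap g (x : UnitAddCircle)) = ∫ x in (0 : ℝ)..1 / 2,
      (fourier (-n) ((-x : ℝ) : UnitAddCircle) : ℂ) • radialMap g ((-x : ℝ) : UnitAddCircle) := by
    rw [intervalIntegral.integral_comp_neg (fun x : ℝ => (fourier (-n) (x : UnitAddCircle) : ℂ) •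
      radialMap g (x : UnitAddCircle))]
    simp
  have hcont' : Continuous fun x : ℝ => (fourier (-n) ((-x : ℝ) : UnitAddCircle) : ℂ) •
      radialMap g ((-x : ℝ) : UnitAddCircle) := hcont.comp continuous_neg
  rw [hneg, ← intervalIntegral.integral_add (hcont'.intervalIntegrable _ _) (hcont.intervalIntegrable _ _),
    ← intervalIntegral.integral_const_mul, ← intervalIntegral.integral_ofReal]
  simp only [one_div, inv_one, one_smul]
  apply intervalIntegral.integral_congr
  intro t ht
  rw [Set.uIcc_of_le (by norm_num)] at ht
  have ht1 : |t| ≤ 1 / 2 := by rw [abs_of_nonneg ht.1]; linarith [ht.2]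
  have ht2 : |-t| ≤ 1 / 2 := by rwa [abs_neg]
  simp only [hchar, radialMap, ContinuousMap.coe_mk, hnorm t ht1, hnorm _ ht2, abs_neg,
    abs_of_nonneg ht.1, smul_eq_mul]
  rw [← add_mul]
  have : Complex.exp ((2 * π * (-n : ℤ) * -t : ℝ) * Complex.I) +
      Complex.exp ((2 * π * (-n : ℤ) * t : ℝ) * Complex.I) =
      ((2 * cos (2 * π * n * t) : ℝ) : ℂ) := by
    push_cast
    rw [Complex.cos]
    rw [mul_div_cancel₀ _ two_ne_zero]
    congr 1 <;> congr 1 <;> ring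
  rw [this]; push_cast; ring

theorem integral_posPart_pow_mul (m : ℕ) (hm : m ≠ 0) {r R : ℝ} (h0 : 0 ≤ r) (hR : r ≤ R)
    {φ : ℝ → ℝ} (hφ : Continuous φ) :
    ∫ t in (0 : ℝ)..R, (max (r - t) 0) ^ m * φ t = ∫ t in (0 : ℝ)..r, (r - t) ^ m * φ t := by
  have hc : Continuous fun t => (max (r - t) 0) ^ m * φ t := by fun_prop
  rw [← intervalIntegral.integral_add_adjacent_intervals (b := r)
      (hc.intervalIntegrable _ _) (hc.intervalIntegrable _ _)]
  have h2 : ∫ t in r..R, (max (r - t) 0) ^ m * φ t = 0 := by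
    refine (intervalIntegral.integral_congr (g := fun _ => (0 : ℝ)) fun t ht => ?_).trans (by simp)
    rw [Set.uIcc_of_le hR] at ht
    simp only
    rw [max_eq_right (by linarith [ht.1]), zero_pow hm, zero_mul]
  rw [h2, add_zero]
  apply intervalIntegral.integral_congr
  intro t ht
  rw [Set.uIcc_of_le h0] at ht
  simp only
  rw [max_eq_left (by linarith [ht.2])]

theorem integral_sub_mul_cos (r : ℝ) {c : ℝ} (hc : c ≠ 0) :
    ∫ t in (0 : ℝ)..r, (r - t) ^ 1 * cos (c * t) = (1 - cos (c * r)) / c ^ 2 := by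
  rw [intervalIntegral.integral_eq_sub_of_hasDerivAt
    (f := fun t => (r - t) * (sin (c * t) / c) - cos (c * t) / c ^ 2)]
  · simp; field_simp; ring
  · intro t _
    have h1 : HasDerivAt (fun t : ℝ => c * t) c t := by simpa using (hasDerivAt_id t).const_mul c
    have h2 := ((hasDerivAt_id t).const_sub r).mul ((h1.sin).div_const c)
    convert! h2.sub ((h1.cos).div_const (c ^ 2)) using 1
    simp; field_simp; ring
  · exact Continuous.intervalIntegrable (by fun_prop) _ _

theorem integral_sub_sq_mul_cos (r : ℝ) {c : ℝ} (hc : c ≠ 0) :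
    ∫ t in (0 : ℝ)..r, (r - t) ^ 2 * cos (c * t) = 2 * (c * r - sin (c * r)) / c ^ 3 := by
  rw [intervalIntegral.integral_eq_sub_of_hasDerivAt
    (f := fun t => (r - t) ^ 2 * (sin (c * t) / c) - 2 * (r - t) * (cos (c * t) / c ^ 2)
      - 2 * (sin (c * t) / c ^ 3))]
  · simp; field_simp; ring
  · intro t _
    have h1 : HasDerivAt (fun t : ℝ => c * t) c t := by simpa using (hasDerivAt_id t).const_mul c
    have h0 := (hasDerivAt_id t).const_sub r
    have h2 := (h0.pow 2).mul ((h1.sin).div_const c)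
    have h3 := (h0.const_mul 2).mul ((h1.cos).div_const (c ^ 2))
    have h4 := ((h1.sin).div_const (c ^ 3)).const_mul 2
    convert! (h2.sub h3).sub h4 using 1
    simp; field_simp; ring
  · exact Continuous.intervalIntegrable (by fun_prop) _ _

theorem integral_sub_pow (r : ℝ) (m : ℕ) :
    ∫ t in (0 : ℝ)..r, (r - t) ^ m = r ^ (m + 1) / (m + 1) := by
  rw [intervalIntegral.integral_comp_sub_left (fun t => t ^ m) r]
  simp [integral_pow]

/-- The profile `t ↦ (r - t)₊ ^ m`. -/
noncomputable def truncPow (m : ℕ) (r : ℝ) : C(ℝ, ℝ) := ⟨fun t => (max (r - t) 0) ^ m, by fun_prop⟩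

theorem fourierCoeff_truncPow_zero {m : ℕ} (hm : m ≠ 0) {r : ℝ} (h0 : 0 ≤ r) (hr : r ≤ 1 / 2) :
    fourierCoeff (radialMap (truncPow m r)) 0 = ((2 * (r ^ (m + 1) / (m + 1)) : ℝ) : ℂ) := by
  rw [fourierCoeff_radialMap]
  congr 2
  simpa [truncPow, integral_sub_pow] using
    integral_posPart_pow_mul m hm h0 hr (φ := fun _ => 1) continuous_const

theorem fourierCoeff_truncPow_one {r : ℝ} (h0 : 0 ≤ r) (hr : r ≤ 1 / 2) {n : ℤ} (hn : n ≠ 0) :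
    fourierCoeff (radialMap (truncPow 1 r)) n =
      ((2 * (1 - cos (2 * π * n * r)) / (2 * π * n) ^ 2 : ℝ) : ℂ) := by
  have hc : (2 * π * n : ℝ) ≠ 0 := by positivity
  rw [fourierCoeff_radialMap, mul_div_assoc, ← integral_sub_mul_cos r hc]
  congr 2
  exact integral_posPart_pow_mul 1 one_ne_zero h0 hr (by fun_prop)

theorem fourierCoeff_truncPow_two {r : ℝ} (h0 : 0 ≤ r) (hr : r ≤ 1 / 2) {n : ℤ} (hn : n ≠ 0) :
    fourierCoeff (radialMap (truncPow 2 r)) n =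
      ((4 * (2 * π * n * r - sin (2 * π * n * r)) / (2 * π * n) ^ 3 : ℝ) : ℂ) := by
  have hc : (2 * π * n : ℝ) ≠ 0 := by positivity
  rw [fourierCoeff_radialMap, show (4 : ℝ) = 2 * 2 by norm_num, mul_assoc 2 2, mul_div_assoc 2,
    ← integral_sub_sq_mul_cos r hc]
  congr 2
  exact integral_posPart_pow_mul 2 two_ne_zero h0 hr (by fun_prop)

/-- Makes the coefficients of the squared kernel strictly positive; those of the tent, multiples of
1 - cos, can vanish. -/
theorem min_le_sub_sin {u : ℝ} (hu : 0 < u) : u * min 1 (u ^ 2) / 10 ≤ u - sin u := by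
  have hs : sin 1 ≤ 0.886 := by
    have := abs_le.1 (Real.sin_bound (x := 1) (by simp))
    norm_num at this ⊢; linarith [this.2]
  rcases le_total u 1 with h | h
  · have h1 := (abs_le.1 (Real.sin_bound (x := u) (by rwa [abs_of_pos hu]))).2
    rw [abs_of_pos hu] at h1
    have h3 : u ^ 4 ≤ u ^ 3 := pow_le_pow_of_le_one hu.le h (by norm_num)
    have : u * min 1 (u ^ 2) ≤ u * u ^ 2 := by gcongr; exact min_le_right _ _
    nlinarith [pow_pos hu 3]
  · have h2 : u * min 1 (u ^ 2) ≤ u * 1 := by gcongr; exact min_le_left _ _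
    -- On [1, 10/9], u - sin u ≥ 1 - sin 1 ≥ 0.114 > u/10; beyond 10/9, sin u ≤ 1 is enough.
    rcases le_total u (10 / 9) with h' | h'
    · have : sin u - sin 1 ≤ u - 1 := by
        have := abs_le.1 (Real.abs_sin_sub_sin_le u 1)
        rw [abs_of_nonneg (by linarith)] at this; exact this.2
      norm_num at hs
      linarith
    · linarith [sin_le_one u]

/-! ### Arcs, balls and empirical mass -/

/-- An arc and its complement sit in balls of total length exactly 1, so a lower bound on the mass
of the arc becomes an upper bound on that of the complement. -/
theorem isTorusInterval_subset_closedBalls {A : Set UnitAddCircle} (hA : IsTorusInterval A) :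
    ∃ (c c' : UnitAddCircle) (r r' : ℝ), 0 ≤ r ∧ 0 ≤ r' ∧ r + r' = 1 / 2 ∧
      A ⊆ Metric.closedBall c r ∧ Aᶜ ⊆ Metric.closedBall c' r' := by
  have huniv : ∀ c : UnitAddCircle, Metric.closedBall c (1 / 2) = Set.univ := fun c =>
    AddCircle.closedBall_eq_univ_of_half_period_le 1 one_ne_zero c (by simp)
  have hball : ∀ m t r : ℝ, |t - m| ≤ r → (t : UnitAddCircle) ∈ Metric.closedBall (m : UnitAddCircle) r := by
    intro m t r h
    rw [Metric.mem_closedBall, dist_eq_norm, ← AddCircle.coe_sub]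
    exact (QuotientAddGroup.norm_mk_le_norm).trans h
  obtain ⟨I, hI, rfl⟩ := hA
  rcases I.eq_empty_or_nonempty with rfl | hne
  · exact ⟨0, 0, 0, 1 / 2, le_rfl, by norm_num, by norm_num, by simp, by rw [huniv]; simp⟩
  by_cases hlong : ∃ a ∈ I, ∃ b ∈ I, a + 1 ≤ b
  · obtain ⟨a, ha, b, hb, hab⟩ := hlong
    have himage : (fun t : ℝ => (t : UnitAddCircle)) '' I = Set.univ := by
      rw [Set.eq_univ_iff_forall]
      intro y
      have : y ∈ (fun t : ℝ => (t : UnitAddCircle)) '' Set.Icc a (a + 1) := by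
        rw [AddCircle.coe_image_Icc_eq]; trivial
      obtain ⟨t, ht, rfl⟩ := this
      exact ⟨t, hI.out ha hb ⟨ht.1, ht.2.trans hab⟩, rfl⟩
    exact ⟨0, 0, 1 / 2, 0, by norm_num, le_rfl, by norm_num, by rw [huniv]; simp,
      by rw [himage]; simp⟩
  push Not at hlong
  obtain ⟨t₀, ht₀⟩ := hne
  have hbelow : BddBelow I := ⟨t₀ - 1, fun t ht => by linarith [hlong t ht t₀ ht₀]⟩
  have habove : BddAbove I := ⟨t₀ + 1, fun t ht => by linarith [hlong t₀ ht₀ t ht]⟩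
  set a := sInf I
  set b := sSup I
  have hat : ∀ t ∈ I, a ≤ t := fun t ht => csInf_le hbelow ht
  have htb : ∀ t ∈ I, t ≤ b := fun t ht => le_csSup habove ht
  have hab : a ≤ b := (hat _ ht₀).trans (htb _ ht₀)
  have hba : b ≤ a + 1 := by
    refine csSup_le ⟨t₀, ht₀⟩ fun t ht => ?_
    have : t - 1 ≤ a := le_csInf ⟨t₀, ht₀⟩ fun u hu => by linarith [hlong u hu t ht]
    linarith
  have hIoo : Set.Ioo a b ⊆ I := by
    intro t ht
    obtain ⟨u, hu, hut⟩ := exists_lt_of_csInf_lt ⟨t₀, ht₀⟩ ht.1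
    obtain ⟨v, hv, htv⟩ := exists_lt_of_lt_csSup ⟨t₀, ht₀⟩ ht.2
    exact hI.out hu hv ⟨hut.le, htv.le⟩
  refine ⟨((a + b) / 2 : ℝ), ((a + b + 1) / 2 : ℝ), (b - a) / 2, (a + 1 - b) / 2, by linarith,
    by linarith, by ring, ?_, ?_⟩
  · rintro _ ⟨t, ht, rfl⟩
    apply hball
    rw [abs_le]
    constructor <;> linarith [hat t ht, htb t ht]
  · intro y hy
    have : y ∈ (fun t : ℝ => (t : UnitAddCircle)) '' Set.Icc a (a + 1) := by
      rw [AddCircle.coe_image_Icc_eq]; trivial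
    obtain ⟨t, ht, rfl⟩ := this
    rcases lt_or_ge t b with h | h
    -- A point outside the arc with t < b can only be the left endpoint, which is also a + 1 and so
    -- lies in the complementary ball.
    · have h1 : t = a := by
        by_contra hne
        exact hy ⟨t, hIoo ⟨lt_of_le_of_ne ht.1 (Ne.symm hne), h⟩, rfl⟩
      have h2 : ((t : ℝ) : UnitAddCircle) = ((a + 1 : ℝ) : UnitAddCircle) := by
        rw [h1, AddCircle.coe_add, AddCircle.coe_period, add_zero]
      simp only [h2]
      apply hball
      rw [abs_le]
      constructor <;> linarith
    · apply hball
      rw [abs_le]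
      constructor <;> linarith [ht.2]

theorem empiricalMass_nonneg (x : ℕ → UnitAddCircle) (N : ℕ) (A : Set UnitAddCircle) :
    0 ≤ empiricalMass x N A := by unfold empiricalMass; positivity

theorem empiricalMass_mono (x : ℕ → UnitAddCircle) (N : ℕ) {A B : Set UnitAddCircle} (h : A ⊆ B) :
    empiricalMass x N A ≤ empiricalMass x N B := by
  unfold empiricalMass
  gcongr

theorem empiricalMass_add_compl (x : ℕ → UnitAddCircle) {N : ℕ} (hN : N ≠ 0)
    (A : Set UnitAddCircle) : empiricalMass x N A + empiricalMass x N Aᶜ = 1 := by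
  classical
  unfold empiricalMass
  rw [← add_div, ← Nat.cast_add]
  simp only [Set.mem_compl_iff]
  rw [div_eq_one_iff_eq (by positivity)]
  have := Finset.card_filter_add_card_filter_not (s := Finset.Icc 1 N) (fun n => x n ∈ A)
  rw [Nat.card_Icc, Nat.add_sub_cancel] at this
  norm_cast

/-- One-sided bounds for closed balls control the discrepancy. -/
theorem discrepancy_le_of_closedBall_le {x : ℕ → UnitAddCircle} {N : ℕ} (hN : N ≠ 0) {X : ℝ}
    (hX : ∀ c r, 0 ≤ r → r ≤ 1 / 2 → empiricalMass x N (Metric.closedBall c r) ≤ 2 * r + X) :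
    discrepancy x N ≤ X := by
  have : Nonempty {A : Set UnitAddCircle // IsTorusInterval A} :=
    ⟨⟨∅, ∅, Set.ordConnected_empty, by simp⟩⟩
  refine ciSup_le fun ⟨A, hA⟩ => ?_
  obtain ⟨c, c', r, r', hr, hr', hrr, hAc, hAc'⟩ := isTorusInterval_subset_closedBalls hA
  have hvol : ∀ {B : Set UnitAddCircle} {c r}, 0 ≤ r → B ⊆ Metric.closedBall c r →
      (volume B).toReal ≤ 2 * r := by
    intro B c r hr h
    refine ENNReal.toReal_le_of_le_ofReal (by linarith) ((measure_mono h).trans ?_)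
    rw [AddCircle.volume_closedBall]
    exact ENNReal.ofReal_le_ofReal (min_le_right _ _)
  -- Subadditivity avoids measurability of A; with r + r' = 1/2 it forces |A| = 2r.
  have hone : 1 ≤ (volume A).toReal + (volume Aᶜ).toReal := by
    rw [← ENNReal.toReal_add (measure_ne_top _ _) (measure_ne_top _ _)]
    have h1 : (volume (Set.univ : Set UnitAddCircle)) ≤ volume A + volume Aᶜ := by
      rw [← Set.union_compl_self A]; exact measure_union_le _ _
    rw [UnitAddCircle.measure_univ] at h1
    simpa using ENNReal.toReal_mono (by simp [measure_ne_top]) h1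
  have h1 := hvol hr hAc
  have h2 := hvol hr' hAc'
  have h3 := (empiricalMass_mono x N hAc).trans (hX c r hr (by linarith))
  have h4 := (empiricalMass_mono x N hAc').trans (hX c' r' hr' (by linarith))
  have h5 := empiricalMass_add_compl x hN A
  rw [abs_le]
  constructor <;> simp only <;> linarith

/-! ### Counting close tuples -/

/-- Tuples with the same multiset as a are rearrangements of a, hence inject into its list of
permutations. This is the source of k!. -/
theorem card_map_univ_eq_le {k : ℕ} (S : Finset (Fin k → ℕ)) (a : Fin k → ℕ) :
    (S.filter fun b => Finset.univ.val.map a = Finset.univ.val.map b).card ≤ k.factorial := by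
  calc _ ≤ (List.ofFn a).permutations.toFinset.card := by
        refine Finset.card_le_card_of_injOn List.ofFn (fun b hb => ?_)
          (List.ofFn_injective.injOn)
        have := (Finset.mem_filter.1 hb).2
        rw [Fin.univ_val_map, Fin.univ_val_map, Multiset.coe_eq_coe] at this
        simpa using this.symm
    _ ≤ (List.ofFn a).permutations.length := List.toFinset_card_le _
    _ = _ := by rw [List.length_permutations, List.length_ofFn]

theorem correlationCount_le (x : ℕ → UnitAddCircle) {k T N s : ℕ} (hs : s ≤ T) :
    correlationCount x k N s ≤ 2 * s + correlationDiscrepancy x k T N := by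
  have := Finset.le_sup' (fun s : ℕ => correlationCount x k N (s : ℝ) - 2 * (s : ℝ))
    (Finset.mem_range_succ_iff.2 hs)
  unfold correlationDiscrepancy
  linarith

theorem correlationDiscrepancy_nonneg (x : ℕ → UnitAddCircle) (k T N : ℕ) :
    0 ≤ correlationDiscrepancy x k T N := by
  have h1 := correlationCount_le x (k := k) (N := N) (Nat.zero_le T)
  have h2 : 0 ≤ correlationCount x k N (0 : ℕ) := by unfold correlationCount; positivity
  simpa using h2.trans h1

open Classical in
/-- The number of close pairs, including those that agree as multisets. -/
theorem card_close_pairs_le (x : ℕ → UnitAddCircle) {k T N s : ℕ} (hN : N ≠ 0) (hs : s ≤ T) :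
    ((((Fintype.piFinset fun _ : Fin k => Finset.Icc 1 N) ×ˢ
      (Fintype.piFinset fun _ : Fin k => Finset.Icc 1 N)).filter
      (fun p : (Fin k → ℕ) × (Fin k → ℕ) =>
        ‖(∑ j, x (p.1 j)) - ∑ j, x (p.2 j)‖ < (s : ℝ) / (N : ℝ) ^ k)).card : ℝ) ≤
      (N : ℝ) ^ k * (k.factorial + 2 * s + correlationDiscrepancy x k T N) := by
  have h1 := correlationCount_le x (k := k) (N := N) hs
  unfold correlationCount at h1
  rw [div_le_iff₀ (by positivity)] at h1
  set P := Fintype.piFinset fun _ : Fin k => Finset.Icc 1 N with hP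
  have hPcard : P.card = N ^ k := by simp [hP]
  have h2 : ((P ×ˢ P).filter fun p : (Fin k → ℕ) × (Fin k → ℕ) =>
      Finset.univ.val.map p.1 = Finset.univ.val.map p.2).card ≤ N ^ k * k.factorial := by
    rw [Finset.card_filter, Finset.sum_product, ← hPcard, ← smul_eq_mul]
    refine Finset.sum_le_card_nsmul _ _ _ fun a _ => ?_
    rw [← Finset.card_filter]
    exact card_map_univ_eq_le P a
  have h3 : ((P ×ˢ P).filter (fun p : (Fin k → ℕ) × (Fin k → ℕ) =>
        ‖(∑ j, x (p.1 j)) - ∑ j, x (p.2 j)‖ < (s : ℝ) / (N : ℝ) ^ k)).card ≤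
      ((P ×ˢ P).filter (fun p : (Fin k → ℕ) × (Fin k → ℕ) =>
        Finset.univ.val.map p.1 = Finset.univ.val.map p.2)).card +
      ((P ×ˢ P).filter (fun p : (Fin k → ℕ) × (Fin k → ℕ) =>
      (Finset.univ.val.map p.1 ≠ Finset.univ.val.map p.2) ∧
        ‖(∑ j, x (p.1 j)) - ∑ j, x (p.2 j)‖ < (s : ℝ) / (N : ℝ) ^ k)).card := by
    refine (Finset.card_le_card fun p hp => ?_).trans (Finset.card_union_le _ _)
    simp only [Finset.mem_union, Finset.mem_filter] at hp ⊢
    tauto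
  have h4 : ((N ^ k * k.factorial : ℕ) : ℝ) = (N : ℝ) ^ k * k.factorial := by push_cast; ring
  have h5 := (Nat.cast_le (α := ℝ)).2 (h3.trans (Nat.add_le_add_right h2 _))
  rw [Nat.cast_add, h4] at h5
  linarith

/-- For z > 0 the right side adds the first ⌈z⌉ odd numbers, giving ⌈z⌉² ≥ z². Only integer
thresholds appear, as in the correlation discrepancy. -/
theorem sq_posPart_le_sum_indicator (T : ℕ) {z : ℝ} (hz : z ≤ T) :
    (max z 0) ^ 2 ≤ ∑ j ∈ Finset.range T, (2 * j + 1 : ℝ) * if (j : ℝ) < z then 1 else 0 := by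
  induction T with
  | zero => simp at hz; simp [hz]
  | succ T ih =>
    rcases le_or_gt z T with h | h
    · rw [Finset.sum_range_succ, if_neg (not_lt.2 h)]
      simpa using ih h
    · have hsum : ∀ M : ℕ, ∑ j ∈ Finset.range M, (2 * j + 1 : ℝ) = (M : ℝ) ^ 2 := by
        intro M
        induction M with
        | zero => simp
        | succ M ihM => rw [Finset.sum_range_succ, ihM]; push_cast; ring
      rw [Finset.sum_congr rfl (g := fun j : ℕ => (2 * j + 1 : ℝ)) fun j hj => ?_, hsum]
      · gcongr
        exact max_le hz (by positivity)
      · rw [if_pos, mul_one]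
        have : (j : ℝ) ≤ T := by exact_mod_cast Finset.mem_range_succ_iff.1 hj
        linarith

/-! ### Weyl sums and their high moment -/

/-- The normalized Weyl sum `(1/N) ∑ e(h x_n)`. -/
noncomputable def weylSum (x : ℕ → UnitAddCircle) (N : ℕ) (h : ℤ) : ℂ :=
  (∑ n ∈ Finset.Icc 1 N, (fourier h (x n) : ℂ)) / N

/-- The weight `min 1 (1 / (2π|h|δ))`. -/
noncomputable def decayWeight (δ : ℝ) (h : ℤ) : ℝ := min 1 (2 * π * |(h : ℝ)| * δ)⁻¹

theorem decayWeight_nonneg {δ : ℝ} (hδ : 0 ≤ δ) (h : ℤ) : 0 ≤ decayWeight δ h := by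
  unfold decayWeight; positivity

theorem decayWeight_le_one (δ : ℝ) (h : ℤ) : decayWeight δ h ≤ 1 := min_le_left _ _

theorem fourier_add_arg (h : ℤ) (y z : UnitAddCircle) :
    (fourier h (y + z) : ℂ) = fourier h y * fourier h z := by
  simp only [fourier_apply, smul_add, AddCircle.toCircle_add, Circle.coe_mul]

theorem fourier_neg_arg (h : ℤ) (y : UnitAddCircle) :
    (fourier h (-y) : ℂ) = (starRingEnd ℂ) (fourier h y) := by
  rw [← fourier_neg]; simp only [fourier_apply, smul_neg, neg_smul]

theorem fourier_sum_arg {ι : Type*} (h : ℤ) (s : Finset ι) (y : ι → UnitAddCircle) :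
    (fourier h (∑ i ∈ s, y i) : ℂ) = ∏ i ∈ s, fourier h (y i) := by
  classical
  induction s using Finset.induction_on with
  | empty => simp
  | insert i s hi ih => rw [Finset.sum_insert hi, Finset.prod_insert hi, fourier_add_arg, ih]

/-- Characters turn sums into products, so the sum over pairs of tuples factors into k copies of ∑
e(h x_n) and k of its conjugate. -/
theorem sum_fourier_differences (x : ℕ → UnitAddCircle) {N : ℕ} (hN : N ≠ 0) (k : ℕ) (h : ℤ) :
    ∑ p ∈ (Fintype.piFinset fun _ : Fin k => Finset.Icc 1 N) ×ˢ
      (Fintype.piFinset fun _ : Fin k => Finset.Icc 1 N),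
      (fourier h ((∑ j, x (p.1 j)) - ∑ j, x (p.2 j)) : ℂ) =
    ((((N : ℝ) ^ k) ^ 2 * ‖weylSum x N h‖ ^ (2 * k) : ℝ) : ℂ) := by
  have hsum : ∑ n ∈ Finset.Icc 1 N, (fourier h (x n) : ℂ) = N * weylSum x N h := by
    unfold weylSum; field_simp
  rw [Finset.sum_product]
  simp_rw [sub_eq_add_neg, fourier_add_arg, fourier_neg_arg, fourier_sum_arg, map_prod,
    ← Finset.mul_sum, ← Finset.sum_mul]
  rw [← Finset.sum_pow' (Finset.Icc 1 N) (fun n => (fourier h (x n) : ℂ)) k,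
    ← Finset.sum_pow' (Finset.Icc 1 N) (fun n => (starRingEnd ℂ) (fourier h (x n) : ℂ)) k,
    ← map_sum (starRingEnd ℂ), hsum, ← map_pow, Complex.mul_conj, Complex.normSq_eq_norm_sq]
  simp only [norm_pow, norm_mul, Complex.norm_natCast]
  congr 1; ring

/-- Quadratic decay makes the Fourier series absolutely summable, so it converges at every point. -/
theorem hasSum_radialMap_truncPow {m : ℕ} {r : ℝ}
    (hbound : ∀ h : ℤ, h ≠ 0 → ‖fourierCoeff (radialMap (truncPow m r)) h‖ ≤ 1 / (h : ℝ) ^ 2)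
    (y : UnitAddCircle) :
    HasSum (fun h => fourierCoeff (radialMap (truncPow m r)) h * (fourier h y : ℂ))
      (((max (r - ‖y‖) 0) ^ m : ℝ) : ℂ) := by
  have hs : Summable (fourierCoeff (radialMap (truncPow m r))) := by
    refine Summable.of_norm_bounded_eventually
      (Real.summable_one_div_int_pow.2 one_lt_two) ?_
    filter_upwards [(Set.finite_singleton (0 : ℤ)).compl_mem_cofinite] with h hh
    exact hbound h hh
  exact has_pointwise_sum_fourier_series_of_summable hs y

theorem norm_fourierCoeff_truncPow_one_le {r : ℝ} (h0 : 0 ≤ r) (hr : r ≤ 1 / 2) {n : ℤ}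
    (hn : n ≠ 0) : ‖fourierCoeff (radialMap (truncPow 1 r)) n‖ ≤ 1 / (n : ℝ) ^ 2 := by
  have hn2 : 0 < (n : ℝ) ^ 2 := by positivity
  rw [fourierCoeff_truncPow_one h0 hr hn, Complex.norm_real, Real.norm_eq_abs, abs_div,
    abs_of_nonneg (by linarith [cos_le_one (2 * π * n * r)]), abs_of_nonneg (by positivity),
    div_le_div_iff₀ (by positivity) hn2]
  have h3 : 4 ≤ 4 * π ^ 2 := by nlinarith [pi_gt_three]
  nlinarith [neg_one_le_cos (2 * π * n * r)]

theorem abs_mul_sub_sin (c δ : ℝ) :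
    (c * δ - sin (c * δ)) / c ^ 3 = (|c| * δ - sin (|c| * δ)) / |c| ^ 3 := by
  rcases abs_cases c with ⟨h, _⟩ | ⟨h, _⟩
  · rw [h]
  · rw [h, neg_mul, sin_neg, show (-c) ^ 3 = -(c ^ 3) by ring, div_neg, ← neg_div]
    congr 1; ring

theorem norm_fourierCoeff_truncPow_two_le {r : ℝ} (h0 : 0 ≤ r) (hr : r ≤ 1 / 2) {n : ℤ}
    (hn : n ≠ 0) : ‖fourierCoeff (radialMap (truncPow 2 r)) n‖ ≤ 1 / (n : ℝ) ^ 2 := by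
  have hn2 : 0 < (n : ℝ) ^ 2 := by positivity
  rw [fourierCoeff_truncPow_two h0 hr hn, Complex.norm_real, Real.norm_eq_abs, mul_div_assoc,
    abs_mul_sub_sin]
  set c := |2 * π * n| with hc
  have hc0 : 0 < c := by positivity
  have hsin : |sin (c * r)| ≤ c * r := by
    simpa [abs_of_nonneg (mul_nonneg hc0.le h0)] using abs_sin_le_abs (x := c * r)
  rw [abs_mul, abs_div, abs_of_pos (pow_pos hc0 3), abs_of_nonneg (by norm_num : (0 : ℝ) ≤ 4)]
  have h1 : |c * r - sin (c * r)| ≤ c := by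
    have := abs_le.1 hsin
    rw [abs_le]; constructor <;> nlinarith
  have hcn : c ^ 2 = 4 * π ^ 2 * (n : ℝ) ^ 2 := by rw [hc, sq_abs]; ring
  calc 4 * (|c * r - sin (c * r)| / c ^ 3) ≤ 4 * (c / c ^ 3) := by gcongr
    _ = 4 / c ^ 2 := by field_simp
    _ ≤ 1 / (n : ℝ) ^ 2 := by
      rw [hcn, div_le_div_iff₀ (by positivity) hn2]
      have : 1 ≤ π ^ 2 := by nlinarith [pi_gt_three]
      nlinarith

/-- With u = 2π|n|δ the coefficient is 4δ³(u - sin u)/u³, to which `min_le_sub_sin` applies. -/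
theorem le_fourierCoeff_truncPow_two {δ : ℝ} (h0 : 0 < δ) {n : ℤ} (hn : n ≠ 0) :
    2 / 5 * δ ^ 3 * decayWeight δ n ^ 2 ≤
      4 * (2 * π * n * δ - sin (2 * π * n * δ)) / (2 * π * n) ^ 3 := by
  rw [mul_div_assoc, abs_mul_sub_sin]
  have hcn : |2 * π * (n : ℝ)| = 2 * π * |(n : ℝ)| := by
    rw [abs_mul, abs_of_pos (by positivity)]
  unfold decayWeight
  rw [hcn]
  set c := 2 * π * |(n : ℝ)|
  have hc0 : 0 < c := by positivity
  have hu : 0 < c * δ := by positivity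
  have h1 := min_le_sub_sin hu
  have h2 : min 1 ((c * δ) ^ 2) = (c * δ) ^ 2 * min 1 (c * δ)⁻¹ ^ 2 := by
    rcases le_total (c * δ) 1 with h | h
    · rw [min_eq_left (one_le_inv_iff₀.2 ⟨hu, h⟩), min_eq_right (pow_le_one₀ hu.le h)]; ring
    · rw [min_eq_right (inv_le_one_of_one_le₀ h), min_eq_left (one_le_pow₀ h)]
      field_simp
  rw [h2] at h1
  calc 2 / 5 * δ ^ 3 * min 1 (c * δ)⁻¹ ^ 2
      = 4 * ((c * δ * ((c * δ) ^ 2 * min 1 (c * δ)⁻¹ ^ 2) / 10) / c ^ 3) := by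
        field_simp; norm_num
    _ ≤ _ := by gcongr

theorem sum_two_mul_add_one_mul (T : ℕ) (A : ℝ) :
    ∑ j ∈ Finset.range T, (2 * j + 1 : ℝ) * (A + 2 * (T - j)) =
      T ^ 2 * A + T * (T + 1) * (2 * T + 1) / 3 := by
  -- The T inside the summand is freed as B so that induction on the range is possible.
  have : ∀ B : ℝ, ∑ j ∈ Finset.range T, (2 * j + 1 : ℝ) * (A + 2 * (B - j)) =
      T ^ 2 * A + 2 * B * T ^ 2 - T * (T - 1) * (4 * T + 1) / 3 := by
    intro B
    induction T with
    | zero => simp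
    | succ T ih => rw [Finset.sum_range_succ, ih]; push_cast; ring
  rw [this]; ring

/-- Layer-cake: after scaling by N^k, threshold j corresponds to the close-pair count at s = T - j.
-/
theorem sum_truncPow_differences_le (x : ℕ → UnitAddCircle) {k T N : ℕ} (hN : N ≠ 0) :
    ∑ p ∈ (Fintype.piFinset fun _ : Fin k => Finset.Icc 1 N) ×ˢ
      (Fintype.piFinset fun _ : Fin k => Finset.Icc 1 N),
      (max ((T : ℝ) / (N : ℝ) ^ k - ‖(∑ j, x (p.1 j)) - ∑ j, x (p.2 j)‖) 0) ^ 2 ≤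
    (T ^ 2 * (k.factorial + correlationDiscrepancy x k T N) + T * (T + 1) * (2 * T + 1) / 3) /
      (N : ℝ) ^ k := by
  classical
  set P := Fintype.piFinset fun _ : Fin k => Finset.Icc 1 N with hP
  set M : ℝ := (N : ℝ) ^ k with hM
  have hM0 : 0 < M := by positivity
  set d : (Fin k → ℕ) × (Fin k → ℕ) → ℝ := fun p => ‖(∑ j, x (p.1 j)) - ∑ j, x (p.2 j)‖ with hd
  calc ∑ p ∈ P ×ˢ P, (max ((T : ℝ) / M - d p) 0) ^ 2
      ≤ ∑ p ∈ P ×ˢ P, ∑ j ∈ Finset.range T, (2 * j + 1 : ℝ) / M ^ 2 *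
          if d p < ((T - j : ℕ) : ℝ) / M then 1 else 0 := by
        refine Finset.sum_le_sum fun p _ => ?_
        have hz : (T : ℝ) - M * d p ≤ T := by
          have : 0 ≤ M * d p := by positivity
          linarith
        have h1 : max ((T : ℝ) / M - d p) 0 = max (T - M * d p) 0 / M := by
          rw [← max_div_div_right hM0.le, zero_div]
          congr 1; field_simp
        rw [h1, div_pow, div_le_iff₀ (by positivity), Finset.sum_mul]
        refine (sq_posPart_le_sum_indicator T hz).trans (Finset.sum_le_sum fun j hj => ?_)
        have hjT : j ≤ T := (Finset.mem_range.1 hj).le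
        have : (j : ℝ) < T - M * d p ↔ d p < ((T - j : ℕ) : ℝ) / M := by
          rw [Nat.cast_sub hjT, lt_div_iff₀ hM0]
          constructor <;> intro h <;> linarith
        simp only [this]
        apply le_of_eq; field_simp
    _ = ∑ j ∈ Finset.range T, (2 * j + 1 : ℝ) / M ^ 2 *
          ((P ×ˢ P).filter fun p => d p < ((T - j : ℕ) : ℝ) / M).card := by
        rw [Finset.sum_comm]
        refine Finset.sum_congr rfl fun j _ => ?_
        rw [← Finset.mul_sum, Finset.sum_boole]
    _ ≤ ∑ j ∈ Finset.range T, (2 * j + 1 : ℝ) / M ^ 2 *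
          (M * ((k.factorial + correlationDiscrepancy x k T N) + 2 * (T - j))) := by
        refine Finset.sum_le_sum fun j hj => ?_
        have hjT : j ≤ T := (Finset.mem_range.1 hj).le
        have := card_close_pairs_le x (k := k) hN (Nat.sub_le T j)
        rw [Nat.cast_sub hjT] at this ⊢
        gcongr
        refine this.trans (le_of_eq ?_)
        rw [hM]; ring
    _ = (∑ j ∈ Finset.range T, (2 * j + 1 : ℝ) *
          ((k.factorial + correlationDiscrepancy x k T N) + 2 * (T - j))) / M := by
        rw [Finset.sum_div]
        refine Finset.sum_congr rfl fun j _ => ?_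
        field_simp
    _ = _ := by rw [sum_two_mul_add_one_mul]

/-- The high moment of the Weyl sums is controlled by the correlation discrepancy. -/
theorem tsum_weylSum_pow_le (x : ℕ → UnitAddCircle) {k T N : ℕ} (hk : 1 ≤ k) (hT : 1 ≤ T)
    (hN : N ≠ 0) (hδ : (T : ℝ) / (N : ℝ) ^ k ≤ 1 / 2) :
    Summable (fun h : ℤ => (if h = 0 then 0 else
      decayWeight ((T : ℝ) / (N : ℝ) ^ k) h * ‖weylSum x N h‖) ^ (2 * k)) ∧
    ∑' h : ℤ, (if h = 0 then 0 else
      decayWeight ((T : ℝ) / (N : ℝ) ^ k) h * ‖weylSum x N h‖) ^ (2 * k) ≤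
      6 * ((k.factorial : ℝ) / T + correlationDiscrepancy x k T N / T) := by
  set D := correlationDiscrepancy x k T N with hD
  have hD0 : 0 ≤ D := correlationDiscrepancy_nonneg x k T N
  set M : ℝ := (N : ℝ) ^ k with hM
  have hM0 : 0 < M := by positivity
  have hT0 : (1 : ℝ) ≤ T := by exact_mod_cast hT
  set δ := (T : ℝ) / M with hδ_def
  have hδ0 : 0 < δ := by positivity
  have hfact : (1 : ℝ) ≤ k.factorial := by exact_mod_cast k.factorial_pos
  set S : ℝ := ∑ p ∈ (Fintype.piFinset fun _ : Fin k => Finset.Icc 1 N) ×ˢ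
      (Fintype.piFinset fun _ : Fin k => Finset.Icc 1 N),
      (max (δ - ‖(∑ j, x (p.1 j)) - ∑ j, x (p.2 j)‖) 0) ^ 2 with hS
  have hSle : S ≤ (T ^ 2 * (k.factorial + D) + T * (T + 1) * (2 * T + 1) / 3) / M :=
    sum_truncPow_differences_le x hN
  set G : ℤ → ℝ := fun h => if h = 0 then 2 * (δ ^ 3 / 3) else
    4 * (2 * π * h * δ - sin (2 * π * h * δ)) / (2 * π * h) ^ 3 with hG
  have hcoeff : ∀ h : ℤ, fourierCoeff (radialMap (truncPow 2 δ)) h = (G h : ℂ) := by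
    intro h
    by_cases h0 : h = 0
    · rw [h0, fourierCoeff_truncPow_zero two_ne_zero hδ0.le hδ]
      simp [hG]; norm_num
    · rw [fourierCoeff_truncPow_two hδ0.le hδ h0]
      simp [hG, h0]
  have hsum : HasSum (fun h : ℤ => G h * (M ^ 2 * ‖weylSum x N h‖ ^ (2 * k))) S := by
    rw [← Complex.hasSum_ofReal, hS, Complex.ofReal_sum]
    have := hasSum_sum (s := (Fintype.piFinset fun _ : Fin k => Finset.Icc 1 N) ×ˢ
      (Fintype.piFinset fun _ : Fin k => Finset.Icc 1 N)) fun p _ => hasSum_radialMap_truncPow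
        (fun h hh => norm_fourierCoeff_truncPow_two_le hδ0.le hδ hh)
        ((∑ j, x (p.1 j)) - ∑ j, x (p.2 j))
    convert! this using 2 with h
    rw [← Finset.mul_sum, sum_fourier_differences x hN, hcoeff, ← Complex.ofReal_mul]
  have hsum' := hasSum_ite_sub_hasSum hsum 0
  have hw0 : ‖weylSum x N 0‖ = 1 := by
    simp [weylSum, hN]
  have hG0 : G 0 = 2 * (δ ^ 3 / 3) := by simp [hG]
  rw [hw0, hG0] at hsum'
  have hsum2 := hsum'.mul_left (5 / (2 * δ ^ 3 * M ^ 2))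
  have hle : ∀ h : ℤ, (if h = 0 then 0 else decayWeight δ h * ‖weylSum x N h‖) ^ (2 * k) ≤
      5 / (2 * δ ^ 3 * M ^ 2) *
        (if h = 0 then 0 else G h * (M ^ 2 * ‖weylSum x N h‖ ^ (2 * k))) := by
    intro h
    split_ifs with h0
    · rw [zero_pow (by omega), mul_zero]
    · have h1 := le_fourierCoeff_truncPow_two hδ0 h0
      -- The weight is at most 1 and 2 ≤ 2k, so the squared weight supplied by the kernel suffices.
      have h2 : decayWeight δ h ^ (2 * k) ≤ decayWeight δ h ^ 2 :=
        pow_le_pow_of_le_one (decayWeight_nonneg hδ0.le h) (decayWeight_le_one δ h) (by omega)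
      have h3 : G h = 4 * (2 * π * h * δ - sin (2 * π * h * δ)) / (2 * π * h) ^ 3 := by
        simp [hG, h0]
      rw [← h3] at h1
      calc _ = decayWeight δ h ^ (2 * k) * ‖weylSum x N h‖ ^ (2 * k) := mul_pow _ _ _
        _ ≤ decayWeight δ h ^ 2 * ‖weylSum x N h‖ ^ (2 * k) := by gcongr
        _ = 5 / (2 * δ ^ 3 * M ^ 2) * ((2 / 5 * δ ^ 3 * decayWeight δ h ^ 2) *
            (M ^ 2 * ‖weylSum x N h‖ ^ (2 * k))) := by field_simp
        _ ≤ _ := by gcongr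
  have hnn : ∀ h : ℤ, 0 ≤ (if h = 0 then 0 else
      decayWeight δ h * ‖weylSum x N h‖) ^ (2 * k) := fun h => by
    rw [pow_mul]; positivity
  have hsm : Summable (fun h : ℤ => (if h = 0 then 0 else
      decayWeight δ h * ‖weylSum x N h‖) ^ (2 * k)) :=
    Summable.of_nonneg_of_le hnn hle hsum2.summable
  refine ⟨hsm, (hsm.tsum_le_tsum hle hsum2.summable).trans ?_⟩
  rw [hsum2.tsum_eq]
  calc 5 / (2 * δ ^ 3 * M ^ 2) * (S - 2 * (δ ^ 3 / 3) * (M ^ 2 * 1 ^ (2 * k)))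
      ≤ 5 / (2 * δ ^ 3 * M ^ 2) * ((T ^ 2 * (k.factorial + D) + T * (T + 1) * (2 * T + 1) / 3) / M
          - 2 * (δ ^ 3 / 3) * (M ^ 2 * 1 ^ (2 * k))) := by gcongr
    -- The cubic terms 2T³/3 of the count and of frequency 0 cancel here.
    _ = 5 / 2 * ((k.factorial + D) / T + (3 * T + 1) / (3 * T ^ 2)) := by
        rw [hδ_def]; field_simp; ring
    _ ≤ 5 / 2 * ((k.factorial + D) / T + 4 / 3 / T) := by
        gcongr 5 / 2 * (_ + ?_)
        rw [div_div, div_le_div_iff₀ (by positivity) (by positivity)]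
        nlinarith
    -- Since k! ≥ 1, the term 4/3 is absorbed: 5/2 · (1 + 4/3) = 35/6 ≤ 6.
    _ ≤ 6 * ((k.factorial : ℝ) / T + D / T) := by
        rw [← add_div, ← add_div, ← mul_div_assoc, ← mul_div_assoc]
        refine div_le_div_of_nonneg_right ?_ (by positivity)
        linarith

/-! ### Hölder's inequality against 1 / |h| -/

/-- The difference between ζ(q) and 1/(q - 1) is 1 minus a nonnegative series. -/
theorem tsum_nat_inv_rpow_le {q : ℝ} (hq : 1 < q) :
    ∑' n : ℕ, 1 / ((n : ℝ) + 1) ^ q ≤ 1 + 1 / (q - 1) := by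
  have h1 := ZetaAsymptotics.zeta_limit_aux1 hq
  have h2 : 0 ≤ ZetaAsymptotics.termTSum q :=
    tsum_nonneg fun n => ZetaAsymptotics.term_nonneg (n + 1) q
  have h3 : 0 ≤ q * ZetaAsymptotics.termTSum q := by positivity
  linarith

theorem hasSum_int_inv_rpow {q : ℝ} (hq : 1 < q) :
    HasSum (fun h : ℤ => (|(h : ℝ)|⁻¹) ^ q) (2 * ∑' n : ℕ, 1 / ((n : ℝ) + 1) ^ q) := by
  have hs : Summable fun n : ℕ => 1 / ((n : ℝ) + 1) ^ q := by
    have := (summable_nat_add_iff 1).2 (Real.summable_one_div_nat_rpow.2 hq)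
    simpa using this
  have h1 : HasSum (fun n : ℕ => (|((n : ℤ) : ℝ)|⁻¹) ^ q) (∑' n : ℕ, 1 / ((n : ℝ) + 1) ^ q) := by
    rw [← hasSum_nat_add_iff' 1]
    convert! hs.hasSum using 1
    · ext n
      rw [abs_of_nonneg (by positivity), Real.inv_rpow (by positivity)]
      push_cast; rw [one_div]
    -- The convention 0⁻¹ = 0 makes the h = 0 term vanish.
    · simp [Real.zero_rpow (by linarith : q ≠ 0)]
  have h2 : HasSum (fun n : ℕ => (|((-((n : ℤ) + 1) : ℤ) : ℝ)|⁻¹) ^ q)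
      (∑' n : ℕ, 1 / ((n : ℝ) + 1) ^ q) := by
    convert! hs.hasSum using 1
    ext n
    push_cast
    rw [abs_neg, abs_of_nonneg (by positivity), Real.inv_rpow (by positivity), one_div]
  rw [two_mul]
  exact HasSum.of_nat_of_neg_add_one h1 h2

/-- Hölder's inequality against the weights `1 / |h|`. -/
theorem tsum_inv_mul_le {k : ℕ} (hk : 1 ≤ k) {b : ℤ → ℝ} (hb : ∀ h, 0 ≤ b h)
    (hs : Summable fun h => b h ^ (2 * k)) {B : ℝ} (hB : ∑' h, b h ^ (2 * k) ≤ B) :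
    Summable (fun h : ℤ => |(h : ℝ)|⁻¹ * b h) ∧
      ∑' h : ℤ, |(h : ℝ)|⁻¹ * b h ≤ 4 * k * B ^ (1 / (2 * (k : ℝ))) := by
  have hk1 : (1 : ℝ) ≤ k := by exact_mod_cast hk
  set p : ℝ := 2 * k with hp
  have hp1 : 1 < p := by linarith
  have hpq : (p.conjExponent).HolderConjugate p := (Real.HolderConjugate.conjExponent hp1).symm
  set q := p.conjExponent with hq
  have hq1 : 1 < q := hpq.lt
  have hq2 : 1 / (q - 1) = p - 1 := by
    rw [hq, Real.conjExponent]
    have : p - 1 ≠ 0 := by linarith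
    field_simp
    -- The exponent conjugate to p = 2k satisfies 1/(q - 1) = 2k - 1, so the two-sided sum is at
    -- most 2(1 + 2k - 1) = 4k.
    ring
  have hsum := hasSum_int_inv_rpow hq1
  have hle : 2 * ∑' n : ℕ, 1 / ((n : ℝ) + 1) ^ q ≤ 4 * k := by
    have := tsum_nat_inv_rpow_le hq1
    rw [hq2] at this
    linarith
  have hpow : ∀ h, b h ^ p = b h ^ (2 * k) := fun h => by
    rw [← Real.rpow_natCast]; push_cast; rfl
  have hs' : Summable fun h => b h ^ p := by simpa only [hpow] using hs
  obtain ⟨h1, h2⟩ := Real.summable_and_inner_le_Lp_mul_Lq_tsum_of_nonneg hpq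
    (f := fun h : ℤ => |(h : ℝ)|⁻¹) (fun h => by positivity) hb hsum.summable hs'
  refine ⟨h1, h2.trans ?_⟩
  rw [hsum.tsum_eq]
  simp only [hpow]
  have h0 : 0 ≤ ∑' h, b h ^ (2 * k) := tsum_nonneg fun h => pow_nonneg (hb h) _
  have hz : 0 ≤ 2 * ∑' n : ℕ, 1 / ((n : ℝ) + 1) ^ q := by
    have : 0 ≤ ∑' n : ℕ, 1 / ((n : ℝ) + 1) ^ q := tsum_nonneg fun n => by positivity
    linarith
  gcongr
  calc (2 * ∑' n : ℕ, 1 / ((n : ℝ) + 1) ^ q) ^ (1 / q) ≤ (4 * k : ℝ) ^ (1 / q) := by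
        gcongr
    _ ≤ (4 * k : ℝ) ^ (1 : ℝ) := by
        refine Real.rpow_le_rpow_of_exponent_le (by linarith) ?_
        rw [div_le_one (by linarith)]; exact hq1.le
    _ = 4 * k := Real.rpow_one _

/-! ### An Erdős–Turán type inequality -/

/-- The coefficient is a difference of cosines over n²δ: the Lipschitz bound handles low
frequencies, the trivial bound 2 handles high ones. -/
theorem norm_trapezoid_coeff_le {r δ : ℝ} (h0 : 0 ≤ r) (hδ : 0 < δ) (hr : r + δ ≤ 1 / 2) {n : ℤ}
    (hn : n ≠ 0) :
    ‖(fourierCoeff (radialMap (truncPow 1 (r + δ))) n -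
      fourierCoeff (radialMap (truncPow 1 r)) n) / (δ : ℂ)‖ ≤ |(n : ℝ)|⁻¹ * decayWeight δ n := by
  rw [fourierCoeff_truncPow_one (by linarith) hr hn,
    fourierCoeff_truncPow_one h0 (by linarith) hn, ← Complex.ofReal_sub, ← Complex.ofReal_div,
    Complex.norm_real, Real.norm_eq_abs]
  set c := 2 * π * (n : ℝ) with hc
  have hcabs : |c| = 2 * π * |(n : ℝ)| := by rw [hc, abs_mul, abs_of_pos (by positivity)]
  have hc0 : 0 < |c| := by positivity
  have hn0 : 0 < |(n : ℝ)| := by positivity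
  have h1 : |cos (c * r) - cos (c * (r + δ))| ≤ |c| * δ := by
    refine (abs_cos_sub_cos_le _ _).trans (le_of_eq ?_)
    rw [← mul_sub, abs_mul, show r - (r + δ) = -δ by ring, abs_neg, abs_of_pos hδ]
  have h2 : |cos (c * r) - cos (c * (r + δ))| ≤ 2 := by
    rw [abs_le]
    constructor <;> linarith [neg_one_le_cos (c * r), cos_le_one (c * r),
      neg_one_le_cos (c * (r + δ)), cos_le_one (c * (r + δ))]
  have heq : (2 * (1 - cos (c * (r + δ))) / c ^ 2 - 2 * (1 - cos (c * r)) / c ^ 2) / δ =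
      2 * (cos (c * r) - cos (c * (r + δ))) / (c ^ 2 * δ) := by
    field_simp; ring
  rw [heq, abs_div, abs_mul, abs_of_pos (by positivity : 0 < c ^ 2 * δ), abs_two, ← sq_abs c]
  unfold decayWeight
  rw [← hcabs, mul_min_of_nonneg _ _ (by positivity), mul_one]
  have hπ : 2 * |(n : ℝ)| * 2 ≤ |c| := by rw [hcabs]; nlinarith [pi_gt_three]
  apply le_min
  · rw [div_le_iff₀ (by positivity)]
    calc 2 * |cos (c * r) - cos (c * (r + δ))| ≤ 2 * (|c| * δ) := by gcongr
      _ = |(n : ℝ)|⁻¹ * ((2 * |(n : ℝ)|) * |c| * δ) := by field_simp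
      _ ≤ |(n : ℝ)|⁻¹ * (|c| * |c| * δ) := by gcongr; linarith
      _ = _ := by ring
  · rw [div_le_iff₀ (by positivity)]
    calc 2 * |cos (c * r) - cos (c * (r + δ))| ≤ 2 * 2 := by gcongr
      _ = |(n : ℝ)|⁻¹ * (2 * |(n : ℝ)| * 2) := by field_simp
      _ ≤ |(n : ℝ)|⁻¹ * |c| := by gcongr
      _ = |(n : ℝ)|⁻¹ * (|c| * δ)⁻¹ * (|c| ^ 2 * δ) := by field_simp

/-- A one-sided Erdős–Turán type inequality with weights decaying beyond frequency `1 / δ`. -/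
theorem empiricalMass_closedBall_le (x : ℕ → UnitAddCircle) {N : ℕ} (hN : N ≠ 0) {r δ : ℝ}
    (h0 : 0 ≤ r) (hδ : 0 < δ) (hr : r + δ ≤ 1 / 2) (c : UnitAddCircle)
    (hs : Summable fun h : ℤ => |(h : ℝ)|⁻¹ *
      (if h = 0 then 0 else decayWeight δ h * ‖weylSum x N h‖)) :
    empiricalMass x N (Metric.closedBall c r) ≤ 2 * r + δ +
      ∑' h : ℤ, |(h : ℝ)|⁻¹ * (if h = 0 then 0 else decayWeight δ h * ‖weylSum x N h‖) := by
  classical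
  -- The trapezoid as a difference of two tents: 1 on the ball of radius r, falling linearly to 0 at
  -- radius r + δ.
  set f : UnitAddCircle → ℝ := fun y => (max (r + δ - ‖y‖) 0 ^ 1 - max (r - ‖y‖) 0 ^ 1) / δ with hf
  set a : ℤ → ℂ := fun h => (fourierCoeff (radialMap (truncPow 1 (r + δ))) h -
      fourierCoeff (radialMap (truncPow 1 r)) h) / (δ : ℂ) with ha
  have hf0 : ∀ y, 0 ≤ f y := fun y => by
    simp only [hf, pow_one]
    refine div_nonneg (sub_nonneg.2 (max_le_max_right _ ?_)) hδ.le
    linarith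
  have hf1 : ∀ y, ‖y‖ ≤ r → 1 ≤ f y := fun y hy => by
    simp only [hf, pow_one]
    rw [max_eq_left (by linarith), max_eq_left (by linarith), le_div_iff₀ hδ]
    linarith
  have hmass : empiricalMass x N (Metric.closedBall c r) ≤
      (∑ n ∈ Finset.Icc 1 N, f (x n - c)) / N := by
    unfold empiricalMass
    gcongr
    rw [Finset.card_filter, Nat.cast_sum]
    refine Finset.sum_le_sum fun n _ => ?_
    split_ifs with h
    · rw [Metric.mem_closedBall, dist_eq_norm] at h
      simpa using hf1 _ h
    · simpa using hf0 _
  have hfs : ∀ y, HasSum (fun h => a h * (fourier h y : ℂ)) ((f y : ℝ) : ℂ) := fun y => by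
    have h1 := hasSum_radialMap_truncPow
      (fun h hh => norm_fourierCoeff_truncPow_one_le (by linarith : 0 ≤ r + δ) hr hh) y
    have h2 := hasSum_radialMap_truncPow
      (fun h hh => norm_fourierCoeff_truncPow_one_le h0 (by linarith : r ≤ 1 / 2) hh) y
    convert! (h1.sub h2).div_const (δ : ℂ) using 1
    · ext h; simp only [ha]; ring
    · simp only [hf]; push_cast; ring
  have hsum : HasSum (fun h => a h * (fourier h (-c) : ℂ) * weylSum x N h)
      (((∑ n ∈ Finset.Icc 1 N, f (x n - c)) / N : ℝ) : ℂ) := by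
    have := (hasSum_sum (s := Finset.Icc 1 N) fun n _ => hfs (x n - c)).div_const (N : ℂ)
    convert! this using 1
    · ext h
      simp only [sub_eq_add_neg, fourier_add_arg, weylSum]
      rw [mul_div_assoc', Finset.mul_sum]
      congr 1
      refine Finset.sum_congr rfl fun n _ => ?_
      ring
    · push_cast; rfl
  have hsum' := hasSum_ite_sub_hasSum hsum 0
  -- The integral of the trapezoid, ((r + δ)² - r²)/δ = 2r + δ.
  have hzero : a 0 * (fourier 0 (-c) : ℂ) * weylSum x N 0 = ((2 * r + δ : ℝ) : ℂ) := by
    have hw : weylSum x N 0 = 1 := by simp [weylSum, hN]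
    rw [hw, fourier_zero, ha]
    simp only
    rw [fourierCoeff_truncPow_zero one_ne_zero (by linarith) hr,
      fourierCoeff_truncPow_zero one_ne_zero h0 (by linarith)]
    rw [mul_one, mul_one, ← Complex.ofReal_sub, ← Complex.ofReal_div]
    congr 1
    field_simp
    norm_num
    ring
  rw [hzero, ← Complex.ofReal_sub] at hsum'
  have hterm : ∀ h : ℤ, ‖(if h = 0 then 0 else a h * (fourier h (-c) : ℂ) * weylSum x N h)‖ ≤
      |(h : ℝ)|⁻¹ * (if h = 0 then 0 else decayWeight δ h * ‖weylSum x N h‖) := by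
    intro h
    split_ifs with hh
    · simp
    · have hone : ‖(fourier h (-c) : ℂ)‖ = 1 := Circle.norm_coe _
      rw [norm_mul, norm_mul, hone, mul_one, ← mul_assoc]
      gcongr
      exact norm_trapezoid_coeff_le h0 hδ hr hh
  have hnorm := hsum'.norm_le_of_bounded hs.hasSum hterm
  rw [Complex.norm_real, Real.norm_eq_abs] at hnorm
  linarith [(abs_le.1 hnorm).2]

end

/-! ### Conclusion -/

theorem theorem2p3 :
    ∃ C : ℝ, 0 < C ∧
      ∀ (x : ℕ → UnitAddCircle) (k T N : ℕ), 1 ≤ k → 1 ≤ T → 1 ≤ N →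
        discrepancy x N ≤
          C * ((T : ℝ) / (N : ℝ) ^ k +
            (k : ℝ) * ((k.factorial : ℝ) / (T : ℝ) + correlationDiscrepancy x k T N / (T : ℝ)) ^
              (1 / (2 * (k : ℝ)))) := by
  -- 24 = 4 · 6: the Hölder factor 4k times the moment constant, with 6^(1/(2k)) ≤ 6.
  refine ⟨24, by norm_num, fun x k T N hk hT hN => ?_⟩
  have hN0 : N ≠ 0 := by omega
  refine discrepancy_le_of_closedBall_le hN0 fun c r hr hr2 => ?_
  have hk1 : (1 : ℝ) ≤ k := by exact_mod_cast hk
  have hT1 : (1 : ℝ) ≤ T := by exact_mod_cast hT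
  have hD := correlationDiscrepancy_nonneg x k T N
  set E := (k.factorial : ℝ) / (T : ℝ) + correlationDiscrepancy x k T N / (T : ℝ) with hE
  have hE0 : 0 ≤ E := by positivity
  set δ := (T : ℝ) / (N : ℝ) ^ k with hδ
  have hδ0 : 0 < δ := by positivity
  have hE1 : 0 ≤ (k : ℝ) * E ^ (1 / (2 * (k : ℝ))) := by positivity
  rcases le_or_gt (r + δ) (1 / 2) with h | h
  · have hb : ∀ h : ℤ, 0 ≤ if h = 0 then 0 else decayWeight δ h * ‖weylSum x N h‖ := fun h => by
      have := decayWeight_nonneg hδ0.le h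
      split_ifs <;> positivity
    obtain ⟨hs, hle⟩ := tsum_weylSum_pow_le x hk hT hN0 (by linarith : δ ≤ 1 / 2)
    obtain ⟨hs', hle'⟩ := tsum_inv_mul_le hk hb hs hle
    have hmain := empiricalMass_closedBall_le x hN0 hr hδ0 h c hs'
    have h6 : (6 * E) ^ (1 / (2 * (k : ℝ))) ≤ 6 * E ^ (1 / (2 * (k : ℝ))) := by
      rw [Real.mul_rpow (by norm_num) hE0]
      gcongr
      calc (6 : ℝ) ^ (1 / (2 * (k : ℝ))) ≤ 6 ^ (1 : ℝ) := by
            refine Real.rpow_le_rpow_of_exponent_le (by norm_num) ?_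
            rw [div_le_one (by positivity)]; linarith
        _ = 6 := Real.rpow_one _
    have h7 : 4 * (k : ℝ) * (6 * E) ^ (1 / (2 * (k : ℝ))) ≤
        4 * (k : ℝ) * (6 * E ^ (1 / (2 * (k : ℝ)))) := by gcongr
    linarith
  -- If r + δ > 1/2, the trivial bound suffices: mass ≤ 1 < 2r + 2δ.
  · have h1 := empiricalMass_add_compl x hN0 (Metric.closedBall c r)
    have h2 := empiricalMass_nonneg x N (Metric.closedBall c r)ᶜ
    linarith
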